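/- Let $n\ge 1$, $m\ge 1$ be integers, let $g_0=\sum_{i=1}^n\varepsilon_i\,dx_i^2$ with $\varepsilon_i\in\{1,-1\}$ be a semi-Euclidean metric on $\mathbb{R}^n$, let $\alpha=(\alpha_1,\dots,\alpha_n)\in\mathbb{R}^n$ be a nonzero vector and put $\xi(x)=\sum_{i=1}^n\alpha_i x_i$ and $\|\alpha\|^2=\sum_{i=1}^n\varepsilon_i\alpha_i^2$. Let $(F^m,g_F)$ be a (nonempty) smooth $m$-dimensional semi-Riemannian manifold. Let $\varphi,f,h,u:\mathbb{R}\to\mathbb{R}$ be smooth functions with $\varphi$ nowhere zero, $f>0$ and $u$ non-constant, and write $\varphi,f,h,u$ also for the functions $\varphi\circ\xi$, $f\circ\xi$, $h\circ\xi$, $u\circ\xi$ on $\mathbb{R}^n$ and for their compositions with the projection $\mathbb{R}^n\times F\to\mathbb{R}^n$. Consider the warped product $(\mathbb{R}^n,\varphi^{-2}g_0)\times_f F^m$, that is, the manifold $\mathbb{R}^n\times F$ with the metric $g=\varphi^{-2}g_0+f^2g_F$, and let $\lambda\in\mathbb{R}$. Assume that $(\mathbb{R}^n\times_f F^m,g,h,u,\lambda)$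 is a gradient Ricci-harmonic soliton (GRHS), that is, there is a constant $\theta\ge 0$ such that $$\mathrm{Ric}_g+\mathrm{Hess}_g\,h-\theta\,\nabla u\otimes\nabla u=\lambda g,\qquad \tau_g u-g(\nabla u,\nabla h)=0$$ on $\mathbb{R}^n\times F$, where $(\nabla u\otimes\nabla u)(X,Y)=du(X)\,du(Y)$ and $\tau_g u=\mathrm{tr}_g(\nabla du)$. If $\|\alpha\|^2=0$, then the soliton is steady and the fiber is Ricci-flat: $\lambda=0$ and $\mathrm{Ric}_{g_F}=0$; in particular, the constant $\mu$ with $\mathrm{Ric}_{g_F}=\mu g_F$ is $\mu=0$. -/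

import Mathlib

set_option maxSynthPendingDepth 3

open scoped Manifold ContDiff

noncomputable section

namespace SemiRiem

/-! ## Tensor calculus in a finite-dimensional coordinate space

`G : E → E →L[ℝ] E →L[ℝ] ℝ` is the coordinate expression of a metric: `G x v w = ∑ gᵢⱼ(x) vⁱ wʲ`. -/

section Coordinates

/-- The trace of a bilinear form `A` with respect to the nondegenerate bilinear form `b`
(in a basis: `∑ bⁱʲ Aᵢⱼ`), that is, the trace of the endomorphism `b⁻¹ ∘ A` (`V` is finite-dimensional in all uses). -/
def metricTrace {V : Type*} [AddCommGroup V] [Module ℝ V] [TopologicalSpace V]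
    [IsTopologicalAddGroup V] [ContinuousSMul ℝ V] (b A : V →L[ℝ] V →L[ℝ] ℝ) : ℝ :=
  LinearMap.trace ℝ V ((b.inverse ∘L A : V →L[ℝ] V) : V →ₗ[ℝ] V)

/-- The bilinear form `(v, w) ↦ b (A v) (A w)`. -/
def bilinComp {V W : Type*} [AddCommGroup V] [Module ℝ V] [TopologicalSpace V]
    [IsTopologicalAddGroup V] [ContinuousSMul ℝ V] [AddCommGroup W] [Module ℝ W]
    [TopologicalSpace W] [IsTopologicalAddGroup W] [ContinuousSMul ℝ W]
    (b : W →L[ℝ] W →L[ℝ] ℝ) (A : V →L[ℝ] W) : V →L[ℝ] V →L[ℝ] ℝ :=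
  (ContinuousLinearMap.precomp ℝ A) ∘L (b ∘L A)

variable {E : Type*} [NormedAddCommGroup E] [NormedSpace ℝ E]

/-- Christoffel symbols of the first kind:
`christoffelFirst G x v w z = (D_v G(w, z) + D_w G(v, z) - D_z G(v, w)) / 2` at `x`. -/
def christoffelFirst (G : E → E →L[ℝ] E →L[ℝ] ℝ) (x : E) : E →L[ℝ] E →L[ℝ] E →L[ℝ] ℝ :=
  let D : E →L[ℝ] E →L[ℝ] E →L[ℝ] ℝ := fderiv ℝ G x
  let T : E →L[ℝ] E →L[ℝ] E →L[ℝ] ℝ :=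
    ((ContinuousLinearMap.flipₗᵢ ℝ E E ℝ).toContinuousLinearEquiv :
      (E →L[ℝ] E →L[ℝ] ℝ) →L[ℝ] (E →L[ℝ] E →L[ℝ] ℝ)) ∘L D.flip
  (1 / 2 : ℝ) • (D + D.flip - T)

theorem christoffelFirst_apply (G : E → E →L[ℝ] E →L[ℝ] ℝ) (x v w z : E) :
    christoffelFirst G x v w z =
      (fderiv ℝ G x v w z + fderiv ℝ G x w v z - fderiv ℝ G x z v w) / 2 := by
  simp [christoffelFirst]
  ring

/-- Christoffel symbols of the second kind (the Levi-Civita connection is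
`∇_v Y = D_v Y + Γ(v, Y)`): `Γ x v w` is the vector with `G x (Γ x v w) z` equal to
`christoffelFirst G x v w z` for all `z`. -/
def christoffel (G : E → E →L[ℝ] E →L[ℝ] ℝ) (x : E) : E →L[ℝ] E →L[ℝ] E :=
  (ContinuousLinearMap.compL ℝ E (E →L[ℝ] ℝ) E (G x).inverse) ∘L christoffelFirst G x

theorem christoffel_apply (G : E → E →L[ℝ] E →L[ℝ] ℝ) (x v w : E) :
    christoffel G x v w = (G x).inverse (christoffelFirst G x v w) := rfl

/-- The endomorphism `v ↦ R(v, w) z`, where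
`R(v, w) z = ∇_v ∇_w z - ∇_w ∇_v z - ∇_[v, w] z` is the Riemann curvature tensor at `x`. -/
def curvatureEnd (G : E → E →L[ℝ] E →L[ℝ] ℝ) (x w z : E) : E →ₗ[ℝ] E where
  toFun v := fderiv ℝ (christoffel G) x v w z - fderiv ℝ (christoffel G) x w v z
    + christoffel G x v (christoffel G x w z) - christoffel G x w (christoffel G x v z)
  map_add' v v' := by
    simp only [map_add, add_apply]
    abel
  map_smul' c v := by
    simp only [map_smul, smul_apply, RingHom.id_apply, smul_sub, smul_add]

/-- The Ricci tensor in coordinates: `Ric(w, z) = tr (v ↦ R(v, w) z)`. -/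
def coordRicci (G : E → E →L[ℝ] E →L[ℝ] ℝ) (x w z : E) : ℝ :=
  LinearMap.trace ℝ E (curvatureEnd G x w z)

/-- The Hessian in coordinates: `Hess h (v, w) = D²h(v, w) - Dh(Γ(v, w))`. -/
def coordHessian (G : E → E →L[ℝ] E →L[ℝ] ℝ) (h : E → ℝ) (x : E) : E →L[ℝ] E →L[ℝ] ℝ :=
  fderiv ℝ (fderiv ℝ h) x - (ContinuousLinearMap.compL ℝ E E ℝ (fderiv ℝ h x)) ∘L christoffel G x

end Coordinates

/-! ## Semi-Riemannian metrics

`M` is a manifold without boundary modelled on a finite-dimensional space `E`. Tensors at `p` are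
computed in the preferred chart at `p`; by tensoriality every chart around `p` gives the same. -/

section Manifolds

variable {E : Type*} [NormedAddCommGroup E] [NormedSpace ℝ E]
  {H : Type*} [TopologicalSpace H] {I : ModelWithCorners ℝ E H}
  {M : Type*} [TopologicalSpace M] [ChartedSpace H M]
  {E' : Type*} [NormedAddCommGroup E'] [NormedSpace ℝ E']
  {H' : Type*} [TopologicalSpace H'] {J : ModelWithCorners ℝ E' H'}
  {N : Type*} [TopologicalSpace N] [ChartedSpace H' N]

variable (I M) in
/-- Fields of bilinear forms on the tangent spaces, i.e. (0,2)-tensor fields. -/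
abbrev BilinField : Type _ :=
  ∀ p : M, TangentSpace I p →L[ℝ] TangentSpace I p →L[ℝ] ℝ

variable (I J) in
/-- The pullback `φ^* b`, `(φ^* b)_p(v, w) = b_{φ p}(dφ_p v, dφ_p w)`. -/
def pullback (φ : M → N) (b : BilinField J N) : BilinField I M := fun p =>
  bilinComp (b (φ p)) (mfderiv I J φ p)

/-- The coordinate expression of `b` in the preferred chart at `p`. -/
def inChart (b : BilinField I M) (p : M) : E → E →L[ℝ] E →L[ℝ] ℝ :=
  pullback 𝓘(ℝ, E) I (extChartAt I p).symm b

variable (I M) in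
/-- A smooth semi-Riemannian metric: a smooth field of nondegenerate symmetric bilinear forms. -/
structure SemiRiemannianMetric where
  toFun : BilinField I M
  symm : ∀ p v w, toFun p v w = toFun p w v
  nondegenerate : ∀ p v, (∀ w, toFun p v w = 0) → v = 0
  smooth : ∀ p, ContDiffOn ℝ ∞ (inChart toFun p) (extChartAt I p).target

variable (I) in
/-- The differential `dh` of a function. -/
def differential (h : M → ℝ) (p : M) : TangentSpace I p →L[ℝ] ℝ :=
  mfderiv I 𝓘(ℝ, ℝ) h p

namespace SemiRiemannianMetric

variable (g : SemiRiemannianMetric I M)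

/-- The Ricci tensor of `g` at `p`, computed in the preferred chart at `p`. -/
def ricci (p : M) (v w : TangentSpace I p) : ℝ :=
  coordRicci (inChart g.toFun p) (extChartAt I p p)
    (mfderiv I 𝓘(ℝ, E) (extChartAt I p) p v) (mfderiv I 𝓘(ℝ, E) (extChartAt I p) p w)

/-- The Hessian of a function `h` at `p`, computed in the preferred chart at `p`. -/
def hessian (h : M → ℝ) : BilinField I M := fun p =>
  bilinComp (coordHessian (inChart g.toFun p) (h ∘ (extChartAt I p).symm) (extChartAt I p p))
    (mfderiv I 𝓘(ℝ, E) (extChartAt I p) p)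

/-- The gradient: `g(∇h, v) = dh(v)` for all `v`. -/
def grad (h : M → ℝ) (p : M) : TangentSpace I p :=
  (g.toFun p).inverse (differential I h p)

/-- The tension field `trace_g (∇ du)` of a map `u : M → (ℝ, dr²)`, i.e. its Laplacian. -/
def tension (u : M → ℝ) (p : M) : ℝ :=
  metricTrace (g.toFun p) (g.hessian u p)

/-- `Ric_g = μ g`. -/
def IsEinsteinWith (μ : ℝ) : Prop :=
  ∀ (p : M) (v w : TangentSpace I p), g.ricci p v w = μ * g.toFun p v w

/-- `Ric_g = 0`. -/
def IsRicciFlat : Prop :=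
  ∀ (p : M) (v w : TangentSpace I p), g.ricci p v w = 0

/-- `((M, g), (ℝ, dr²), u, h, lam)` is a gradient Ricci-harmonic soliton: `h`, `u` are smooth and,
for some constant `θ ≥ 0`, `Ric_g + Hess h - θ ∇u ⊗ ∇u = lam g` (where `(∇u ⊗ ∇u)(v, w) = du(v) du(w)`) and
`τ_g u - g(∇u, ∇h) = 0`. -/
structure IsGRHS (h u : M → ℝ) (lam : ℝ) : Prop where
  smooth_potential : ContMDiff I 𝓘(ℝ, ℝ) ∞ h
  smooth_map : ContMDiff I 𝓘(ℝ, ℝ) ∞ u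
  soliton : ∃ θ : ℝ, 0 ≤ θ ∧ ∀ (p : M) (v w : TangentSpace I p),
    g.ricci p v w + g.hessian h p v w
      - θ * (differential I u p v * differential I u p w) = lam * g.toFun p v w
  harmonic : ∀ p : M, g.tension u p - g.toFun p (g.grad u p) (g.grad h p) = 0

end SemiRiemannianMetric

/-! ## Warped products -/

/-- The tensor field `π^* g_B + (f ∘ π)² σ^* g_F` on `B × F`. -/
def warpedField (gB : BilinField I M) (gF : BilinField J N) (f : M → ℝ) :
    BilinField (I.prod J) (M × N) := fun p =>
  pullback (I.prod J) I Prod.fst gB p + (f p.1) ^ 2 • pullback (I.prod J) J Prod.snd gF p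

theorem warpedField_apply (gB : BilinField I M) (gF : BilinField J N) (f : M → ℝ)
    (p : M × N) (v w : TangentSpace (I.prod J) p) :
    warpedField gB gF f p v w = gB p.1 v.1 w.1 + (f p.1) ^ 2 * gF p.2 v.2 w.2 := by
  simp only [warpedField, pullback, mfderiv_fst, mfderiv_snd]
  rfl

theorem inChart_apply (b : BilinField I M) (p : M) (x : E) :
    inChart b p x = bilinComp (b ((extChartAt I p).symm x))
      (mfderiv 𝓘(ℝ, E) I (extChartAt I p).symm x) := rfl

theorem inChart_warpedField [I.Boundaryless] [J.Boundaryless] [IsManifold I ∞ M]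
    [IsManifold J ∞ N] (gB : BilinField I M) (gF : BilinField J N) (f : M → ℝ) (p : M × N)
    (x : E × E') (hx : x ∈ (extChartAt (I.prod J) p).target) :
    inChart (warpedField gB gF f) p x =
      bilinComp (inChart gB p.1 x.1) (.fst ℝ E E')
        + (f ((extChartAt I p.1).symm x.1)) ^ 2 •
          bilinComp (inChart gF p.2 x.2) (.snd ℝ E E') := by
  have hx1 : x.1 ∈ (extChartAt I p.1).target := by
    rw [extChartAt_prod] at hx
    exact hx.1
  have hx2 : x.2 ∈ (extChartAt J p.2).target := by
    rw [extChartAt_prod] at hx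
    exact hx.2
  have h1 : MDifferentiableAt 𝓘(ℝ, E) I (extChartAt I p.1).symm x.1 := by
    have := mdifferentiableWithinAt_extChartAt_symm (I := I) hx1
    rwa [I.range_eq_univ, mdifferentiableWithinAt_univ] at this
  have h2 : MDifferentiableAt 𝓘(ℝ, E') J (extChartAt J p.2).symm x.2 := by
    have := mdifferentiableWithinAt_extChartAt_symm (I := J) hx2
    rwa [J.range_eq_univ, mdifferentiableWithinAt_univ] at this
  have hs : ((extChartAt (I.prod J) p).symm : E × E' → M × N) =
      Prod.map (extChartAt I p.1).symm (extChartAt J p.2).symm := by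
    rw [extChartAt_prod]
    rfl
  have hd : mfderiv 𝓘(ℝ, E × E') (I.prod J) (extChartAt (I.prod J) p).symm x =
      (mfderiv 𝓘(ℝ, E) I (extChartAt I p.1).symm x.1).prodMap
        (mfderiv 𝓘(ℝ, E') J (extChartAt J p.2).symm x.2) := by
    rw [hs, modelWithCornersSelf_prod, ← chartedSpaceSelf_prod]
    exact mfderiv_prodMap h1 h2
  refine ContinuousLinearMap.ext fun v => ContinuousLinearMap.ext fun w => ?_
  rw [inChart_apply, hd]
  change warpedField gB gF f ((extChartAt (I.prod J) p).symm x) _ _ = _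
  rw [warpedField_apply, hs]
  rfl

theorem contDiff_bilinComp {V W : Type*} [NormedAddCommGroup V] [NormedSpace ℝ V]
    [NormedAddCommGroup W] [NormedSpace ℝ W] (A : V →L[ℝ] W) :
    ContDiff ℝ ∞ (fun b : W →L[ℝ] W →L[ℝ] ℝ => bilinComp b A) := by
  unfold bilinComp
  fun_prop

/-- The warped product `M ×_f N`: the manifold `M × N` with the metric
`π^* g_B + (f ∘ π)² σ^* g_F`, where `f : M → ℝ` is smooth and positive. -/
def warpedProduct [I.Boundaryless] [J.Boundaryless] [IsManifold I ∞ M] [IsManifold J ∞ N]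
    (gB : SemiRiemannianMetric I M) (gF : SemiRiemannianMetric J N) (f : M → ℝ)
    (hf : ContMDiff I 𝓘(ℝ, ℝ) ∞ f) (hpos : ∀ p, 0 < f p) :
    SemiRiemannianMetric (I.prod J) (M × N) where
  toFun := warpedField gB.toFun gF.toFun f
  symm p v w := by
    refine (warpedField_apply _ _ _ p v w).trans
      (Eq.trans ?_ (warpedField_apply _ _ _ p w v).symm)
    exact congrArg₂ (· + (f p.1) ^ 2 * ·) (gB.symm p.1 v.1 w.1) (gF.symm p.2 v.2 w.2)
  nondegenerate p v hv := by
    refine Prod.ext (gB.nondegenerate p.1 v.1 fun w => ?_) (gF.nondegenerate p.2 v.2 fun w => ?_)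
    · have := (warpedField_apply _ _ _ p v (w, (0 : E'))).symm.trans (hv (w, (0 : E')))
      have h0 : gF.toFun p.2 v.2 (0 : TangentSpace J p.2) = 0 := map_zero _
      change gB.toFun p.1 v.1 w + (f p.1) ^ 2 * gF.toFun p.2 v.2 (0 : TangentSpace J p.2) = 0
        at this
      rw [h0] at this
      simpa using this
    · have := (warpedField_apply _ _ _ p v ((0 : E), w)).symm.trans (hv ((0 : E), w))
      have h0 : gB.toFun p.1 v.1 (0 : TangentSpace I p.1) = 0 := map_zero _
      change gB.toFun p.1 v.1 (0 : TangentSpace I p.1) + (f p.1) ^ 2 * gF.toFun p.2 v.2 w = 0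
        at this
      rw [h0, zero_add] at this
      exact (mul_eq_zero.1 this).resolve_left (pow_pos (hpos _) 2).ne'
  smooth p := by
    refine ContDiffOn.congr ?_ (inChart_warpedField gB.toFun gF.toFun f p)
    have hm1 : Set.MapsTo Prod.fst (extChartAt (I.prod J) p).target
        (extChartAt I p.1).target := fun x hx => by
      rw [extChartAt_prod] at hx
      exact hx.1
    have hm2 : Set.MapsTo Prod.snd (extChartAt (I.prod J) p).target
        (extChartAt J p.2).target := fun x hx => by
      rw [extChartAt_prod] at hx
      exact hx.2
    have hB := (gB.smooth p.1).comp (contDiff_fst (𝕜 := ℝ) (n := ∞)).contDiffOn hm1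
    have hF := (gF.smooth p.2).comp (contDiff_snd (𝕜 := ℝ) (n := ∞)).contDiffOn hm2
    have hf' : ContDiffOn ℝ ∞ (fun y => f ((extChartAt I p.1).symm y)) (extChartAt I p.1).target :=
      contMDiffOn_iff_contDiffOn.1 (hf.comp_contMDiffOn (contMDiffOn_extChartAt_symm p.1))
    have hf'' := hf'.comp (contDiff_fst (𝕜 := ℝ) (n := ∞)).contDiffOn hm1
    exact ((contDiff_bilinComp _).comp_contDiffOn hB).add
      ((hf''.pow 2).smul ((contDiff_bilinComp _).comp_contDiffOn hF))

end Manifolds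

/-! ## Conformal semi-Euclidean spaces -/

section SemiEuclidean

variable {n : ℕ}

/-- The semi-Euclidean scalar product `g₀(v, w) = ∑ εᵢ vᵢ wᵢ` on `ℝⁿ`, with `εᵢ = ±1`. -/
def semiEuclidean (ε : Fin n → ℤˣ) :
    EuclideanSpace ℝ (Fin n) →L[ℝ] EuclideanSpace ℝ (Fin n) →L[ℝ] ℝ :=
  ∑ i, ((ε i : ℤ) : ℝ) •
    (EuclideanSpace.proj i : EuclideanSpace ℝ (Fin n) →L[ℝ] ℝ).smulRight
      (EuclideanSpace.proj i : EuclideanSpace ℝ (Fin n) →L[ℝ] ℝ)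

theorem semiEuclidean_apply (ε : Fin n → ℤˣ) (v w : EuclideanSpace ℝ (Fin n)) :
    semiEuclidean ε v w = ∑ i, ((ε i : ℤ) : ℝ) * (v i * w i) := by
  simp [semiEuclidean]

theorem semiEuclidean_symm (ε : Fin n → ℤˣ) (v w : EuclideanSpace ℝ (Fin n)) :
    semiEuclidean ε v w = semiEuclidean ε w v := by
  simp only [semiEuclidean_apply, mul_comm (v _)]

theorem semiEuclidean_nondegenerate (ε : Fin n → ℤˣ) (v : EuclideanSpace ℝ (Fin n))
    (hv : ∀ w, semiEuclidean ε v w = 0) : v = 0 := by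
  ext i
  have h := hv (EuclideanSpace.single i (1 : ℝ))
  rw [semiEuclidean_apply] at h
  simpa [Pi.single_apply] using h

theorem inChart_self {E : Type*} [NormedAddCommGroup E] [NormedSpace ℝ E]
    (b : BilinField 𝓘(ℝ, E) E) (p x : E) : inChart b p x = b x := by
  have hd : mfderiv 𝓘(ℝ, E) 𝓘(ℝ, E) (extChartAt 𝓘(ℝ, E) p).symm x = .id ℝ E := by
    rw [extChartAt_model_space_eq_id]
    exact mfderiv_id
  rw [inChart_apply, hd]
  rfl

/-- The metric `φ⁻² g₀` on `ℝⁿ`, where `φ : ℝⁿ → ℝ` is smooth and has no zeros. -/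
def conformalMetric (ε : Fin n → ℤˣ) (φ : EuclideanSpace ℝ (Fin n) → ℝ)
    (hφ : ContDiff ℝ ∞ φ) (hφ0 : ∀ x, φ x ≠ 0) :
    SemiRiemannianMetric (𝓡 n) (EuclideanSpace ℝ (Fin n)) where
  toFun x := ((φ x) ^ 2)⁻¹ • semiEuclidean ε
  symm x v w := by
    exact congrArg (((φ x) ^ 2)⁻¹ * ·) (semiEuclidean_symm ε v w)
  nondegenerate x v hv := by
    exact semiEuclidean_nondegenerate ε v fun w =>
      (mul_eq_zero.1 (hv w)).resolve_left (inv_ne_zero (pow_ne_zero 2 (hφ0 x)))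
  smooth p := by
    refine ContDiffOn.congr (f := fun x => ((φ x) ^ 2)⁻¹ • semiEuclidean ε) ?_
      (fun x _ => inChart_self _ p x)
    exact (((hφ.pow 2).inv fun x => pow_ne_zero 2 (hφ0 x)).smul contDiff_const).contDiffOn

/-- The linear function `ξ(x) = ∑ αᵢ xᵢ` on `ℝⁿ`. -/
def xi (α x : EuclideanSpace ℝ (Fin n)) : ℝ := ∑ i, α i * x i

theorem contDiff_xi (α : EuclideanSpace ℝ (Fin n)) : ContDiff ℝ ∞ (xi α) := by
  unfold xi
  fun_prop

end SemiEuclidean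

end SemiRiem

end

open SemiRiem

/-! Let `l = ξ` and let `a` be the `g₀`-gradient of `ξ`. The hypothesis `‖α‖² = 0` says `l a = 0`:
`a` is null, and every function of `ξ` is invariant under translation by `a`.

Write the metric as `ψ(ξ) g₀ + κ(ξ) γ` with `ψ = φ⁻²`, `κ = f²`, and `γ` the fibre metric in a
chart. In the Christoffel formula `Γ((a,0), ·)` cancels, since `g₀(a, ·) = l` and `l a = 0`; the
coordinate field `(a,0)` is parallel. Hence Ricci and the Hessian of `h` vanish when one argument is
`(a,0)`, and so does `du(a,0)`. Pairing `(a,0)` with `(α,0)` in the soliton equation leaves `0 = λ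
φ⁻² ξ(α)`, where `ξ(α)` is the Euclidean square norm of `α ≠ 0`; so `λ = 0`.

On vertical vectors the base part of `Γ` is a multiple of `a`. Functions of `ξ` do not see it, so
Hessian and `du` terms vanish. It adds to the Ricci trace only a rank-one block `v ↦ L(v) a` with
`L(a) = 0`, so vertical Ricci is that of the fibre. With `λ = 0` the fibre is Ricci-flat. The
carrying lemmas are `warpedChristoffel_null_left`, `coordRicci_warpedCoord_null` and
`coordRicci_warpedCoord_fiber`. -/

noncomputable section

namespace SemiRiem

/-! ### Linear algebra: nondegenerate forms and traces. -/

section Algebra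

variable {V W : Type*} [NormedAddCommGroup V] [NormedSpace ℝ V] [FiniteDimensional ℝ V]
  [NormedAddCommGroup W] [NormedSpace ℝ W] [FiniteDimensional ℝ W]

/-- Injectivity plus equality of dimensions of `V` and its dual. This guarantees that `inverse` in
the Christoffel symbols is a true inverse, not the default value `0`. -/
theorem isInvertible_of_nondegenerate (b : V →L[ℝ] V →L[ℝ] ℝ)
    (hb : ∀ v, (∀ w, b v w = 0) → v = 0) : b.IsInvertible := by
  have hinj : Function.Injective (b : V →ₗ[ℝ] V →L[ℝ] ℝ) := by
    rw [← LinearMap.ker_eq_bot, LinearMap.ker_eq_bot']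
    exact fun v hv => hb v fun w => by
      have := congrArg (fun T : V →L[ℝ] ℝ => T w) hv
      exact this
  have hd : Module.finrank ℝ V = Module.finrank ℝ (V →L[ℝ] ℝ) := by
    rw [← (LinearMap.toContinuousLinearMap (𝕜 := ℝ) (E := V) (F' := ℝ)).finrank_eq]
    exact (Subspace.dual_finrank_eq (K := ℝ) (V := V)).symm
  exact ⟨(LinearEquiv.ofInjectiveOfFinrankEq (b : V →ₗ[ℝ] V →L[ℝ] ℝ) hinj hd).toContinuousLinearEquiv,
    ContinuousLinearMap.ext fun v => rfl⟩

theorem trace_eq_trace_blocks (T : V × W →ₗ[ℝ] V × W) :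
    LinearMap.trace ℝ (V × W) T =
      LinearMap.trace ℝ V (LinearMap.fst ℝ V W ∘ₗ T ∘ₗ LinearMap.inl ℝ V W) +
        LinearMap.trace ℝ W (LinearMap.snd ℝ V W ∘ₗ T ∘ₗ LinearMap.inr ℝ V W) := by
  have hT : T = (T ∘ₗ LinearMap.inl ℝ V W) ∘ₗ LinearMap.fst ℝ V W +
      (T ∘ₗ LinearMap.inr ℝ V W) ∘ₗ LinearMap.snd ℝ V W := by
    refine LinearMap.ext fun x => ?_
    simp [← map_add]
  conv_lhs => rw [hT, map_add, LinearMap.trace_comp_comm', LinearMap.trace_comp_comm' (LinearMap.snd ℝ V W)]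

theorem trace_eq_zero_of_forall_eq_smul {T : V →ₗ[ℝ] V} {l : V →ₗ[ℝ] ℝ} {a : V}
    (hT : ∀ v, T v = l v • a) (ha : l a = 0) : LinearMap.trace ℝ V T = 0 := by
  have : T = l.smulRight a := LinearMap.ext fun v => by simp [hT]
  rw [this, LinearMap.trace_smulRight, ha]

end Algebra

/-! ### Invariant functions, and general facts on Christoffel symbols. -/

section Calculus

variable {E : Type*} [NormedAddCommGroup E] [NormedSpace ℝ E]
  {X : Type*} [NormedAddCommGroup X] [NormedSpace ℝ X]

/-- No differentiability is needed: where `F` is not differentiable, `fderiv` is `0` by default. -/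
theorem fderiv_apply_eq_zero_of_invariant {F : E → X} {k : E}
    (hF : ∀ (x : E) (s : ℝ), F (x + s • k) = F x) (x : E) : fderiv ℝ F x k = 0 := by
  by_cases hd : DifferentiableAt ℝ F x
  · rw [← hd.lineDeriv_eq_fderiv, lineDeriv]
    simp [hF]
  · simp [fderiv_zero_of_not_differentiableAt hd]

/-- The derivative of a translation-invariant function is itself invariant under the same
translations. -/
theorem fderiv_fderiv_apply_eq_zero_of_invariant {F : E → X} {k : E}
    (hF : ∀ (x : E) (s : ℝ), F (x + s • k) = F x) (x : E) :
    fderiv ℝ (fderiv ℝ F) x k = 0 := by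
  refine fderiv_apply_eq_zero_of_invariant (fun y s => ?_) x
  rw [← fderiv_comp_add_right]
  simp only [hF]

theorem christoffel_eq_of_forall {G : E → E →L[ℝ] E →L[ℝ] ℝ} {x v w u : E}
    (hG : (G x).IsInvertible) (h : ∀ z, G x u z = christoffelFirst G x v w z) :
    christoffel G x v w = u := by
  rw [christoffel_apply, ← ContinuousLinearMap.ext h, hG.inverse_apply_self]

theorem christoffel_spec {G : E → E →L[ℝ] E →L[ℝ] ℝ} {x : E} (hG : (G x).IsInvertible)
    (v w z : E) : G x (christoffel G x v w) z = christoffelFirst G x v w z := by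
  rw [christoffel_apply, hG.self_apply_inverse]

/-- Inversion is smooth near an invertible operator, so `Γ` is built from the differentiable maps
`G⁻¹` and `DG`. -/
theorem differentiableAt_christoffel [CompleteSpace E] {G : E → E →L[ℝ] E →L[ℝ] ℝ} {x : E}
    (hG : ContDiffAt ℝ ∞ G x) (hx : (G x).IsInvertible) :
    DifferentiableAt ℝ (christoffel G) x := by
  have h1 : DifferentiableAt ℝ (fderiv ℝ G) x :=
    (hG.fderiv_right (m := 1) (by norm_cast)).differentiableAt one_ne_zero
  have h2 : DifferentiableAt ℝ (fun y => (G y).inverse) x :=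
    ((hx.contDiffAt_map_inverse (n := 1)).comp x (hG.of_le (by norm_cast))).differentiableAt
      one_ne_zero
  have h3 : DifferentiableAt ℝ (christoffelFirst G) x := by
    unfold christoffelFirst
    have h4 : DifferentiableAt ℝ (fun y => (fderiv ℝ G y).flip) x :=
      (ContinuousLinearMap.flipₗᵢ ℝ E E (E →L[ℝ] ℝ)).toContinuousLinearEquiv.differentiableAt.comp
        x h1
    exact DifferentiableAt.const_smul (R := ℝ) ((h1.add h4).sub ((differentiableAt_const _).clm_comp h4)) _
  unfold christoffel
  exact ((ContinuousLinearMap.compL ℝ E (E →L[ℝ] ℝ) E).differentiableAt.comp x h2).clm_comp h3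

/-- Reduces the derivative of the operator-valued `Γ` to derivatives of its values on fixed vectors,
for which explicit formulas are available. -/
theorem fderiv_apply_apply {F : E → E →L[ℝ] E →L[ℝ] X} {x : E} (hF : DifferentiableAt ℝ F x)
    (v w z : E) : fderiv ℝ F x v w z = fderiv ℝ (fun y => F y w z) x v := by
  have h1 : DifferentiableAt ℝ (fun y => F y w) x := hF.clm_apply (differentiableAt_const w)
  rw [fderiv_clm_apply h1 (differentiableAt_const z), fderiv_clm_apply hF (differentiableAt_const w)]
  simp

theorem christoffel_eventuallyEq {G G' : E → E →L[ℝ] E →L[ℝ] ℝ} {x : E}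
    (h : G =ᶠ[nhds x] G') : christoffel G =ᶠ[nhds x] christoffel G' := by
  filter_upwards [h.eventuallyEq_nhds] with y hy
  simp only [christoffel, christoffelFirst, hy.fderiv_eq, hy.eq_of_nhds]

/-- Ricci depends only on the germ of the metric, and the chart expression is known to have warped
form only on the chart target. -/
theorem coordRicci_congr {G G' : E → E →L[ℝ] E →L[ℝ] ℝ} {x : E} (h : G =ᶠ[nhds x] G') (w z : E) :
    coordRicci G x w z = coordRicci G' x w z := by
  have h1 := christoffel_eventuallyEq h
  have : curvatureEnd G x w z = curvatureEnd G' x w z := LinearMap.ext fun v => by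
    simp only [curvatureEnd, LinearMap.coe_mk, AddHom.coe_mk, h1.fderiv_eq, h1.eq_of_nhds]
  rw [coordRicci, coordRicci, this]

theorem coordHessian_congr {G G' : E → E →L[ℝ] E →L[ℝ] ℝ} {x : E} (h : G =ᶠ[nhds x] G')
    (H : E → ℝ) : coordHessian G H x = coordHessian G' H x := by
  rw [coordHessian, coordHessian, (christoffel_eventuallyEq h).eq_of_nhds]

theorem coordHessian_apply (G : E → E →L[ℝ] E →L[ℝ] ℝ) (H : E → ℝ) (x v w : E) :
    coordHessian G H x v w =
      fderiv ℝ (fderiv ℝ H) x v w - fderiv ℝ H x (christoffel G x v w) := rfl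

end Calculus

/-! ### Christoffel symbols of the warped metric. -/

section WarpedCoordinates

variable {E E' : Type*} [NormedAddCommGroup E] [NormedSpace ℝ E]
  [NormedAddCommGroup E'] [NormedSpace ℝ E']

/-- The coordinate expression `ψ(ℓ x) b + κ(ℓ x) γ(y)` of a warped product metric. -/
def warpedCoord (b : E →L[ℝ] E →L[ℝ] ℝ) (l : E →L[ℝ] ℝ) (ψ κ : ℝ → ℝ)
    (γ : E' → E' →L[ℝ] E' →L[ℝ] ℝ) (x : E × E') : E × E' →L[ℝ] E × E' →L[ℝ] ℝ :=
  ψ (l x.1) • bilinComp b (.fst ℝ E E') + κ (l x.1) • bilinComp (γ x.2) (.snd ℝ E E')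

variable {b : E →L[ℝ] E →L[ℝ] ℝ} {l : E →L[ℝ] ℝ} {ψ κ : ℝ → ℝ}
  {γ : E' → E' →L[ℝ] E' →L[ℝ] ℝ} {a : E} {x : E × E'}

theorem warpedCoord_apply (x v w : E × E') :
    warpedCoord b l ψ κ γ x v w = ψ (l x.1) * b v.1 w.1 + κ (l x.1) * γ x.2 v.2 w.2 := rfl

theorem contDiffAt_warpedCoord (hψ : ContDiff ℝ ∞ ψ) (hκ : ContDiff ℝ ∞ κ)
    (hγ : ContDiffAt ℝ ∞ γ x.2) : ContDiffAt ℝ ∞ (warpedCoord b l ψ κ γ) x := by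
  unfold warpedCoord
  have h1 : ContDiffAt ℝ ∞ (fun y : E × E' => l y.1) x := by fun_prop
  have h2 : ContDiffAt ℝ ∞ (fun y : E × E' => bilinComp (γ y.2) (.snd ℝ E E')) x :=
    (contDiff_bilinComp _).contDiffAt.comp x (hγ.comp x contDiffAt_snd)
  exact ((hψ.contDiffAt.comp x h1).smul contDiffAt_const).add ((hκ.contDiffAt.comp x h1).smul h2)

theorem fderiv_warpedCoord_apply (hψ : ContDiff ℝ ∞ ψ) (hκ : ContDiff ℝ ∞ κ)
    (hγ : ContDiffAt ℝ ∞ γ x.2) (v w z : E × E') :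
    fderiv ℝ (warpedCoord b l ψ κ γ) x v w z =
      deriv ψ (l x.1) * l v.1 * b w.1 z.1 + deriv κ (l x.1) * l v.1 * γ x.2 w.2 z.2
        + κ (l x.1) * fderiv ℝ γ x.2 v.2 w.2 z.2 := by
  have hl : HasFDerivAt (fun y : E × E' => l y.1) (l ∘L .fst ℝ E E') x :=
    (l ∘L ContinuousLinearMap.fst ℝ E E').hasFDerivAt
  have h1 := (hψ.differentiable (by simp) (l x.1)).hasDerivAt.comp_hasFDerivAt x hl
  have h2 := (hκ.differentiable (by simp) (l x.1)).hasDerivAt.comp_hasFDerivAt x hl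
  have h3 : HasFDerivAt (fun y : E × E' => γ y.2 w.2 z.2) _ x :=
    (((hγ.differentiableAt (by simp)).hasFDerivAt.comp x (hasFDerivAt_snd (𝕜 := ℝ) (p := x))).clm_apply
      (hasFDerivAt_const w.2 x)).clm_apply (hasFDerivAt_const z.2 x)
  have h4 := (h1.mul_const (b w.1 z.1)).add (h2.mul h3)
  rw [fderiv_apply_apply ((contDiffAt_warpedCoord hψ hκ hγ).differentiableAt (by simp))]
  refine (congrArg (· v) h4.fderiv).trans ?_
  simp
  ring

/-- The Christoffel symbols of a warped product metric `ψ(ℓ x) b + κ(ℓ x) γ(y)`, where `a` is the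
`b`-gradient of `ℓ`. -/
def warpedChristoffel (b : E →L[ℝ] E →L[ℝ] ℝ) (l : E →L[ℝ] ℝ) (ψ κ : ℝ → ℝ)
    (γ : E' → E' →L[ℝ] E' →L[ℝ] ℝ) (a : E) (x v w : E × E') : E × E' :=
  ((deriv ψ (l x.1) / (2 * ψ (l x.1))) • (l v.1 • w.1 + l w.1 • v.1 - b v.1 w.1 • a)
      - (deriv κ (l x.1) / (2 * ψ (l x.1)) * γ x.2 v.2 w.2) • a,
    (deriv κ (l x.1) / (2 * κ (l x.1))) • (l v.1 • w.2 + l w.1 • v.2)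
      + christoffel γ x.2 v.2 w.2)

/-- In the base part `l w • a` cancels against `b a w • a`, and the remaining terms carry a factor
`l a` or a zero fibre vector. This is where nullity makes `(a, 0)` parallel. -/
theorem warpedChristoffel_null_left (ha : b a = l) (hl : l a = 0) (w : E × E') :
    warpedChristoffel b l ψ κ γ a x (a, 0) w = 0 := by
  simp [warpedChristoffel, ha, hl]

variable [FiniteDimensional ℝ E] [FiniteDimensional ℝ E']

theorem isInvertible_warpedCoord (hb : b.IsInvertible) (hγ : (γ x.2).IsInvertible)
    (hψ0 : ∀ t, ψ t ≠ 0) (hκ0 : ∀ t, κ t ≠ 0) : (warpedCoord b l ψ κ γ x).IsInvertible := by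
  refine isInvertible_of_nondegenerate _ fun v hv => Prod.ext (hb.injective ?_) (hγ.injective ?_)
  · refine ContinuousLinearMap.ext fun w => ?_
    have := hv (w, 0)
    rw [warpedCoord_apply] at this
    simpa [hψ0] using this
  · refine ContinuousLinearMap.ext fun w => ?_
    have := hv (0, w)
    rw [warpedCoord_apply] at this
    simpa [hκ0] using this

/-- By nondegeneracy it suffices to check the closed formula after pairing with an arbitrary `z`. -/
theorem christoffel_warpedCoord (hψ : ContDiff ℝ ∞ ψ) (hκ : ContDiff ℝ ∞ κ)
    (hψ0 : ∀ t, ψ t ≠ 0) (hκ0 : ∀ t, κ t ≠ 0) (hb : b.IsInvertible) (ha : b a = l)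
    (hγ : ContDiffAt ℝ ∞ γ x.2) (hγ0 : (γ x.2).IsInvertible) (v w : E × E') :
    christoffel (warpedCoord b l ψ κ γ) x v w = warpedChristoffel b l ψ κ γ a x v w := by
  refine christoffel_eq_of_forall (isInvertible_warpedCoord hb hγ0 hψ0 hκ0) fun z => ?_
  -- The fibre's own defining identity absorbs all derivatives of `γ`.
  have h := christoffel_spec hγ0 v.2 w.2 z.2
  rw [christoffelFirst_apply] at h
  rw [christoffelFirst_apply, warpedCoord_apply]
  simp only [fderiv_warpedCoord_apply hψ hκ hγ, warpedChristoffel, map_add, map_sub, map_smul,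
    add_apply, sub_apply, smul_apply, h, ha, smul_eq_mul]
  field_simp [hψ0 (l x.1), hκ0 (l x.1)]
  ring

end WarpedCoordinates

/-! ### Ricci and Hessian along the null direction and along the fibre. -/

section WarpedRicci

variable {E E' : Type*} [NormedAddCommGroup E] [NormedSpace ℝ E] [FiniteDimensional ℝ E]
  [NormedAddCommGroup E'] [NormedSpace ℝ E'] [FiniteDimensional ℝ E']
  {b : E →L[ℝ] E →L[ℝ] ℝ} {l : E →L[ℝ] ℝ} {ψ κ : ℝ → ℝ}
  {γ : E' → E' →L[ℝ] E' →L[ℝ] ℝ} {a : E} {x : E × E'}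

theorem christoffel_warpedCoord_eventuallyEq (hψ : ContDiff ℝ ∞ ψ) (hκ : ContDiff ℝ ∞ κ)
    (hψ0 : ∀ t, ψ t ≠ 0) (hκ0 : ∀ t, κ t ≠ 0) (hb : b.IsInvertible) (ha : b a = l)
    (hγ : ∀ᶠ y in nhds x.2, ContDiffAt ℝ ∞ γ y ∧ (γ y).IsInvertible) (v w : E × E') :
    (fun y => christoffel (warpedCoord b l ψ κ γ) y v w) =ᶠ[nhds x]
      fun y => warpedChristoffel b l ψ κ γ a y v w := by
  filter_upwards [continuousAt_snd.eventually hγ] with y hy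
  exact christoffel_warpedCoord hψ hκ hψ0 hκ0 hb ha hy.1 hy.2 v w

theorem differentiableAt_warpedChristoffel (hψ : ContDiff ℝ ∞ ψ) (hκ : ContDiff ℝ ∞ κ)
    (hψ0 : ∀ t, ψ t ≠ 0) (hκ0 : ∀ t, κ t ≠ 0) (hb : b.IsInvertible) (ha : b a = l)
    (hγ : ∀ᶠ y in nhds x.2, ContDiffAt ℝ ∞ γ y ∧ (γ y).IsInvertible) (v w : E × E') :
    DifferentiableAt ℝ (fun y => warpedChristoffel b l ψ κ γ a y v w) x := by
  have h := differentiableAt_christoffel (contDiffAt_warpedCoord (b := b) (l := l) hψ hκ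
    hγ.self_of_nhds.1) (isInvertible_warpedCoord hb hγ.self_of_nhds.2 hψ0 hκ0)
  exact ((h.clm_apply (differentiableAt_const v)).clm_apply
    (differentiableAt_const w)).congr_of_eventuallyEq
    (christoffel_warpedCoord_eventuallyEq hψ hκ hψ0 hκ0 hb ha hγ v w).symm

/-- Curvature differentiates `Γ`, so the closed formula must hold near `x`; hence the neighbourhood
hypothesis on `γ`. -/
theorem curvatureEnd_warpedCoord (hψ : ContDiff ℝ ∞ ψ) (hκ : ContDiff ℝ ∞ κ)
    (hψ0 : ∀ t, ψ t ≠ 0) (hκ0 : ∀ t, κ t ≠ 0) (hb : b.IsInvertible) (ha : b a = l)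
    (hγ : ∀ᶠ y in nhds x.2, ContDiffAt ℝ ∞ γ y ∧ (γ y).IsInvertible) (v w z : E × E') :
    curvatureEnd (warpedCoord b l ψ κ γ) x w z v =
      fderiv ℝ (fun y => warpedChristoffel b l ψ κ γ a y w z) x v
        - fderiv ℝ (fun y => warpedChristoffel b l ψ κ γ a y v z) x w
        + warpedChristoffel b l ψ κ γ a x v (warpedChristoffel b l ψ κ γ a x w z)
        - warpedChristoffel b l ψ κ γ a x w (warpedChristoffel b l ψ κ γ a x v z) := by
  have hd := differentiableAt_christoffel (contDiffAt_warpedCoord (b := b) (l := l) hψ hκ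
    hγ.self_of_nhds.1) (isInvertible_warpedCoord hb hγ.self_of_nhds.2 hψ0 hκ0)
  have h := christoffel_warpedCoord_eventuallyEq hψ hκ hψ0 hκ0 hb ha hγ
  have h' : ∀ v w, christoffel (warpedCoord b l ψ κ γ) x v w = _ := fun v w => (h v w).eq_of_nhds
  simp only [curvatureEnd, LinearMap.coe_mk, AddHom.coe_mk, fderiv_apply_apply hd,
    (h _ _).fderiv_eq, h']

/-- The whole endomorphism `v ↦ R(v, (a,0)) z` vanishes, since `Γ((a,0), ·) = 0` and the
coefficients of `Γ` are constant along `(a,0)`. -/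
theorem coordRicci_warpedCoord_null (hψ : ContDiff ℝ ∞ ψ) (hκ : ContDiff ℝ ∞ κ)
    (hψ0 : ∀ t, ψ t ≠ 0) (hκ0 : ∀ t, κ t ≠ 0) (hb : b.IsInvertible) (ha : b a = l) (hl : l a = 0)
    (hγ : ∀ᶠ y in nhds x.2, ContDiffAt ℝ ∞ γ y ∧ (γ y).IsInvertible) (z : E × E') :
    coordRicci (warpedCoord b l ψ κ γ) x (a, 0) z = 0 := by
  have : curvatureEnd (warpedCoord b l ψ κ γ) x (a, 0) z = 0 := LinearMap.ext fun v => by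
    rw [curvatureEnd_warpedCoord hψ hκ hψ0 hκ0 hb ha hγ]
    have h : fderiv ℝ (fun y => warpedChristoffel b l ψ κ γ a y v z) x (a, 0) = 0 :=
      fderiv_apply_eq_zero_of_invariant (fun y s => by simp [warpedChristoffel, hl]) x
    have h0 : warpedChristoffel b l ψ κ γ a x v 0 = 0 := by simp [warpedChristoffel]
    simp only [warpedChristoffel_null_left ha hl, h, h0]
    simp
  rw [coordRicci, this, map_zero]

/-- The trace splits into a base block, of rank at most one with image in the line of `a` and trace
zero, and a fibre block equal to the curvature endomorphism of `γ`. The usual warping corrections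
vanish because `a` is null. -/
theorem coordRicci_warpedCoord_fiber (hψ : ContDiff ℝ ∞ ψ) (hκ : ContDiff ℝ ∞ κ)
    (hψ0 : ∀ t, ψ t ≠ 0) (hκ0 : ∀ t, κ t ≠ 0) (hb : b.IsInvertible)
    (hsymm : ∀ v w, b v w = b w v) (ha : b a = l) (hl : l a = 0)
    (hγ : ∀ᶠ y in nhds x.2, ContDiffAt ℝ ∞ γ y ∧ (γ y).IsInvertible) (w z : E') :
    coordRicci (warpedCoord b l ψ κ γ) x (0, w) (0, z) = coordRicci γ x.2 w z := by
  have hba : ∀ v, b v a = l v := fun v => by rw [hsymm, ha]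
  have hT := fun v => curvatureEnd_warpedCoord hψ hκ hψ0 hκ0 hb ha hγ v (0, w) (0, z)
  have hdC := differentiableAt_warpedChristoffel hψ hκ hψ0 hκ0 hb ha hγ
  have hdγ := differentiableAt_christoffel hγ.self_of_nhds.1 hγ.self_of_nhds.2
  have h1 : ∀ v w z, (fderiv ℝ (fun y => warpedChristoffel b l ψ κ γ a y w z) x v).1 =
      fderiv ℝ (fun y => (warpedChristoffel b l ψ κ γ a y w z).1) x v := fun v w z => by
    rw [fderiv.fst (hdC w z)]; rfl
  have h2 : ∀ v w z, (fderiv ℝ (fun y => warpedChristoffel b l ψ κ γ a y w z) x v).2 =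
      fderiv ℝ (fun y => (warpedChristoffel b l ψ κ γ a y w z).2) x v := fun v w z => by
    rw [fderiv.snd (hdC w z)]; rfl
  have h3 : ∀ (v u u' : E'), fderiv ℝ (fun y : E × E' => christoffel γ y.2 u u') x (0, v) =
      fderiv ℝ (christoffel γ) x.2 v u u' := fun v u u' => by
    rw [fderiv_apply_apply hdγ]
    have hd : DifferentiableAt ℝ (fun y => christoffel γ y u u') x.2 :=
      (hdγ.clm_apply (differentiableAt_const u)).clm_apply (differentiableAt_const u')
    have := hd.hasFDerivAt.comp x (hasFDerivAt_snd (𝕜 := ℝ) (p := x))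
    exact congrArg (fun T : E × E' →L[ℝ] E' => T (0, v)) this.fderiv
  -- The base part of `Γ((0,w),(0,z))` is `-d • a`.
  set d : E × E' → ℝ := fun y => deriv κ (l y.1) / (2 * ψ (l y.1)) * γ y.2 w z with hd
  have hdd : DifferentiableAt ℝ d x := by
    have hκ' : Differentiable ℝ (deriv κ) :=
      (contDiff_infty_iff_deriv.1 hκ).2.differentiable (by simp)
    have hψ' : Differentiable ℝ ψ := hψ.differentiable (by simp)
    have hγ' : DifferentiableAt ℝ γ x.2 := hγ.self_of_nhds.1.differentiableAt (by simp)
    have hγ2 : DifferentiableAt ℝ (fun y : E × E' => γ y.2 w z) x :=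
      ((hγ'.comp x differentiableAt_snd).clm_apply
        (differentiableAt_const w)).clm_apply (differentiableAt_const z)
    have hl' : DifferentiableAt ℝ (fun y : E × E' => l y.1) x := by fun_prop
    have h4 : DifferentiableAt ℝ (fun y : E × E' => deriv κ (l y.1)) x := (hκ' _).comp x hl'
    have h5 : DifferentiableAt ℝ (fun y : E × E' => 2 * ψ (l y.1)) x :=
      ((hψ' _).comp x hl').const_mul 2
    have h6 : 2 * ψ (l x.1) ≠ 0 := mul_ne_zero two_ne_zero (hψ0 _)
    simp only [hd, div_eq_mul_inv]
    exact (h4.fun_mul (h5.fun_inv h6)).fun_mul hγ2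
  have hinv : fderiv ℝ d x (a, 0) = 0 :=
    fderiv_apply_eq_zero_of_invariant (fun y s => by simp [hd, hl]) x
  rw [coordRicci, trace_eq_trace_blocks]
  have hbase : LinearMap.trace ℝ E (LinearMap.fst ℝ E E' ∘ₗ
      curvatureEnd (warpedCoord b l ψ κ γ) x (0, w) (0, z) ∘ₗ LinearMap.inl ℝ E E') = 0 := by
    -- The first summand of the functional comes from differentiating `-d • a`, the second from
    -- `Γ((0,w), Γ((v,0),(0,z)))`. Both kill `a`.
    refine trace_eq_zero_of_forall_eq_smul
      (l := -((fderiv ℝ d x : E × E' →ₗ[ℝ] ℝ) ∘ₗ LinearMap.inl ℝ E E') +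
        (deriv κ (l x.1) / (2 * κ (l x.1)) * d x) • (l : E →ₗ[ℝ] ℝ))
      (a := a) (fun v => ?_) (by simp [hinv, hl])
    have h4 : fderiv ℝ (fun y => (warpedChristoffel b l ψ κ γ a y (0, w) (0, z)).1) x (v, 0) =
        -(fderiv ℝ d x (v, 0) • a) := by
      have : (fun y => (warpedChristoffel b l ψ κ γ a y (0, w) (0, z)).1) = fun y => -(d y • a) := by
        funext y
        simp [warpedChristoffel, hd]
      rw [this, (hdd.hasFDerivAt.smul_const a).fun_neg.fderiv]
      rfl
    have h5 : (fun y => (warpedChristoffel b l ψ κ γ a y (v, 0) (0, z)).1) = fun y => 0 := by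
      funext y
      simp [warpedChristoffel]
    simp only [LinearMap.comp_apply, LinearMap.inl_apply, LinearMap.fst_apply, hT, Prod.fst_add,
      Prod.fst_sub, h1, h4, h5]
    simp [warpedChristoffel, hl, hba, hd]
    module
  have hfib : LinearMap.snd ℝ E E' ∘ₗ
      curvatureEnd (warpedCoord b l ψ κ γ) x (0, w) (0, z) ∘ₗ LinearMap.inr ℝ E E' =
      curvatureEnd γ x.2 w z := by
    refine LinearMap.ext fun v => ?_
    have h4 : ∀ u u', (fun y => (warpedChristoffel b l ψ κ γ a y (0, u) (0, u')).2) =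
        fun y => christoffel γ y.2 u u' := fun u u' => by
      funext y
      simp [warpedChristoffel]
    simp only [LinearMap.comp_apply, LinearMap.inr_apply, LinearMap.snd_apply, hT, Prod.snd_add,
      Prod.snd_sub, h2, h4, h3]
    -- The base part of an inner `Γ` is a multiple of `a` and enters the outer fibre part only
    -- through `l`, so it drops out.
    simp [warpedChristoffel, hl, curvatureEnd]
  rw [hbase, hfib, zero_add, coordRicci]

theorem coordHessian_warpedCoord_null (hψ : ContDiff ℝ ∞ ψ) (hκ : ContDiff ℝ ∞ κ)
    (hψ0 : ∀ t, ψ t ≠ 0) (hκ0 : ∀ t, κ t ≠ 0) (hb : b.IsInvertible) (ha : b a = l) (hl : l a = 0)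
    (hγ : ContDiffAt ℝ ∞ γ x.2) (hγ0 : (γ x.2).IsInvertible) (H : ℝ → ℝ) (z : E × E') :
    coordHessian (warpedCoord b l ψ κ γ) (fun y => H (l y.1)) x (a, 0) z = 0 := by
  rw [coordHessian_apply, christoffel_warpedCoord hψ hκ hψ0 hκ0 hb ha hγ hγ0,
    warpedChristoffel_null_left ha hl,
    fderiv_fderiv_apply_eq_zero_of_invariant fun y s => by simp [hl]]
  simp

theorem coordHessian_warpedCoord_fiber (hψ : ContDiff ℝ ∞ ψ) (hκ : ContDiff ℝ ∞ κ)
    (hψ0 : ∀ t, ψ t ≠ 0) (hκ0 : ∀ t, κ t ≠ 0) (hb : b.IsInvertible) (ha : b a = l) (hl : l a = 0)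
    (hγ : ContDiffAt ℝ ∞ γ x.2) (hγ0 : (γ x.2).IsInvertible) (H : ℝ → ℝ) (w z : E') :
    coordHessian (warpedCoord b l ψ κ γ) (fun y => H (l y.1)) x (0, w) (0, z) = 0 := by
  rw [coordHessian_apply, christoffel_warpedCoord hψ hκ hψ0 hκ0 hb ha hγ hγ0,
    fderiv_fderiv_apply_eq_zero_of_invariant fun y s => by simp,
    -- `Γ((0,w),(0,z))` has base part along `a`, and `H ∘ l` is constant in that direction.
    fderiv_apply_eq_zero_of_invariant fun y s => by simp [warpedChristoffel, hl]]
  simp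

end WarpedRicci

/-! ### From tensors on the manifold to the preferred chart. -/

section Charts

variable {E : Type*} [NormedAddCommGroup E] [NormedSpace ℝ E]
  {H : Type*} [TopologicalSpace H] {I : ModelWithCorners ℝ E H} 
  {M : Type*} [TopologicalSpace M] [ChartedSpace H M]

/-- The inverse chart has invertible derivative on the open chart target, so nondegeneracy of `g`
passes to coordinates. -/
theorem eventually_contDiffAt_inChart [I.Boundaryless] [IsManifold I ∞ M] [FiniteDimensional ℝ E] (g : SemiRiemannianMetric I M)
    (p : M) : ∀ᶠ y in nhds (extChartAt I p p),
      ContDiffAt ℝ ∞ (inChart g.toFun p) y ∧ (inChart g.toFun p y).IsInvertible := by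
  filter_upwards [extChartAt_target_mem_nhds (I := I) p] with y hy
  have hopen := isOpen_extChartAt_target (I := I) p
  refine ⟨(g.smooth p).contDiffAt (hopen.mem_nhds hy),
    isInvertible_of_nondegenerate _ fun v hv => ?_⟩
  have : IsManifold I 1 M := IsManifold.of_le (n := ∞) (by simp)
  have hA := isInvertible_mfderivWithin_extChartAt_symm (I := I) hy
  rw [I.range_eq_univ, mfderivWithin_univ] at hA
  have h0 : mfderiv 𝓘(ℝ, E) I (extChartAt I p).symm y v = 0 := by
    refine g.nondegenerate _ _ fun w => ?_
    obtain ⟨w', rfl⟩ := hA.surjective w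
    exact hv w'
  exact hA.injective (h0.trans (map_zero _).symm)

/-- The preferred chart at `p` has identity derivative at `p`, so tangent vectors are their own
coordinates. -/
theorem ricci_eq [IsManifold I ∞ M] (g : SemiRiemannianMetric I M) (p : M) (v w : TangentSpace I p) :
    g.ricci p v w = coordRicci (inChart g.toFun p) (extChartAt I p p) v w := by
  have : IsManifold I 1 M := IsManifold.of_le (n := ∞) (by simp)
  rw [SemiRiemannianMetric.ricci, mfderiv_extChartAt_self]
  rfl

theorem hessian_eq [IsManifold I ∞ M] (g : SemiRiemannianMetric I M) (h : M → ℝ) (p : M) (v w : TangentSpace I p) :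
    g.hessian h p v w = coordHessian (inChart g.toFun p) (h ∘ (extChartAt I p).symm)
      (extChartAt I p p) v w := by
  have : IsManifold I 1 M := IsManifold.of_le (n := ∞) (by simp)
  rw [SemiRiemannianMetric.hessian, mfderiv_extChartAt_self]
  rfl

theorem differential_eq [I.Boundaryless] (h : M → ℝ) (p : M) (hh : MDifferentiableAt I 𝓘(ℝ, ℝ) h p)
    (v : TangentSpace I p) : differential I h p v =
      fderiv ℝ (h ∘ (extChartAt I p).symm) (extChartAt I p p) v := by
  rw [differential, hh.mfderiv, I.range_eq_univ, fderivWithin_univ]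
  rfl

end Charts

/-! ### The function `ξ`, its gradient, and the soliton equation in coordinates. -/

section SemiEuclidean

variable {n : ℕ}

/-- `ξ` as a continuous linear functional. -/
def xiCLM (α : EuclideanSpace ℝ (Fin n)) : EuclideanSpace ℝ (Fin n) →L[ℝ] ℝ :=
  ∑ i, α i • EuclideanSpace.proj i

theorem xiCLM_apply (α x : EuclideanSpace ℝ (Fin n)) : xiCLM α x = xi α x := by
  simp [xiCLM, xi]

/-- The `g₀`-gradient of `ξ`. -/
def xiGrad (ε : Fin n → ℤˣ) (α : EuclideanSpace ℝ (Fin n)) : EuclideanSpace ℝ (Fin n) :=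
  WithLp.toLp 2 fun i => ((ε i : ℤ) : ℝ) * α i

theorem semiEuclidean_xiGrad (ε : Fin n → ℤˣ) (α : EuclideanSpace ℝ (Fin n)) :
    semiEuclidean ε (xiGrad ε α) = xiCLM α := by
  refine ContinuousLinearMap.ext fun v => ?_
  rw [semiEuclidean_apply, xiCLM_apply, xi]
  refine Finset.sum_congr rfl fun i _ => ?_
  have h : ((ε i : ℤ) : ℝ) * ((ε i : ℤ) : ℝ) = 1 := by
    exact_mod_cast Int.units_coe_mul_self (ε i)
  simp only [xiGrad]
  linear_combination α i * v i * h

/-- Turns the hypothesis `‖α‖² = 0` into `l a = 0`. -/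
theorem xiCLM_xiGrad (ε : Fin n → ℤˣ) (α : EuclideanSpace ℝ (Fin n)) :
    xiCLM α (xiGrad ε α) = ∑ i, ((ε i : ℤ) : ℝ) * α i ^ 2 := by
  rw [xiCLM_apply, xi]
  refine Finset.sum_congr rfl fun i _ => ?_
  simp only [xiGrad]
  ring

/-- Supplies a vector not `g₀`-orthogonal to the null gradient: `ξ(α)` is the positive definite
square norm, not the indefinite one. -/
theorem xiCLM_self_ne_zero {α : EuclideanSpace ℝ (Fin n)} (hα : α ≠ 0) : xiCLM α α ≠ 0 := by
  have : xiCLM α α = ‖α‖ ^ 2 := by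
    rw [xiCLM_apply, xi, EuclideanSpace.real_norm_sq_eq]
    exact Finset.sum_congr rfl fun i _ => (sq _).symm
  rw [this]
  exact pow_ne_zero 2 (norm_ne_zero_iff.2 hα)

theorem isInvertible_semiEuclidean (ε : Fin n → ℤˣ) : (semiEuclidean ε).IsInvertible :=
  isInvertible_of_nondegenerate _ (semiEuclidean_nondegenerate ε)

variable {m : ℕ} {F : Type*} [TopologicalSpace F] [ChartedSpace (EuclideanSpace ℝ (Fin m)) F]
    [IsManifold (𝓡 m) ∞ F]

theorem inChart_warpedProduct_eventuallyEq
    (gF : SemiRiemannianMetric (𝓡 m) F) (ε : Fin n → ℤˣ) (α : EuclideanSpace ℝ (Fin n))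
    (φ f : ℝ → ℝ) (hφ : ContDiff ℝ ∞ φ) (hφ0 : ∀ t, φ t ≠ 0)
    (hf : ContDiff ℝ ∞ f) (hf0 : ∀ t, 0 < f t) (p : EuclideanSpace ℝ (Fin n) × F) :
    inChart (warpedProduct
        (conformalMetric ε (fun x => φ (xi α x)) (hφ.comp (contDiff_xi α)) (fun x => hφ0 (xi α x)))
        gF (fun x => f (xi α x)) (hf.comp (contDiff_xi α)).contMDiff
        (fun x => hf0 (xi α x))).toFun p =ᶠ[nhds (extChartAt ((𝓡 n).prod (𝓡 m)) p p)]
      warpedCoord (semiEuclidean ε) (xiCLM α) (fun t => (φ t ^ 2)⁻¹) (fun t => f t ^ 2)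
        (inChart gF.toFun p.2) := by
  filter_upwards [extChartAt_target_mem_nhds (I := (𝓡 n).prod (𝓡 m)) p] with x hx
  refine (inChart_warpedField _ gF.toFun _ p x hx).trans ?_
  rw [inChart_self]
  simp only [warpedCoord, xiCLM_apply]
  rfl

/-- The soliton equation in the product chart. -/
theorem soliton_warpedCoord
    (gF : SemiRiemannianMetric (𝓡 m) F)
    (ε : Fin n → ℤˣ) (α : EuclideanSpace ℝ (Fin n))
    (φ f h u : ℝ → ℝ)
    (hφ : ContDiff ℝ ∞ φ) (hφ0 : ∀ t, φ t ≠ 0)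
    (hf : ContDiff ℝ ∞ f) (hf0 : ∀ t, 0 < f t)
    (lam : ℝ)
    (hG : (warpedProduct
        (conformalMetric ε (fun x => φ (xi α x)) (hφ.comp (contDiff_xi α)) (fun x => hφ0 (xi α x)))
        gF (fun x => f (xi α x)) (hf.comp (contDiff_xi α)).contMDiff
        (fun x => hf0 (xi α x))).IsGRHS
      (fun p => h (xi α p.1)) (fun p => u (xi α p.1)) lam) :
    ∃ θ : ℝ, ∀ (p : EuclideanSpace ℝ (Fin n) × F)
      (v w : EuclideanSpace ℝ (Fin n) × EuclideanSpace ℝ (Fin m)),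
      coordRicci (warpedCoord (semiEuclidean ε) (xiCLM α) (fun t => (φ t ^ 2)⁻¹) (fun t => f t ^ 2)
          (inChart gF.toFun p.2)) (p.1, extChartAt (𝓡 m) p.2 p.2) v w
        + coordHessian (warpedCoord (semiEuclidean ε) (xiCLM α) (fun t => (φ t ^ 2)⁻¹)
          (fun t => f t ^ 2) (inChart gF.toFun p.2)) (fun y => h (xiCLM α y.1))
            (p.1, extChartAt (𝓡 m) p.2 p.2) v w
        - θ * (fderiv ℝ (fun y => u (xiCLM α y.1)) (p.1, extChartAt (𝓡 m) p.2 p.2) v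
          * fderiv ℝ (fun y => u (xiCLM α y.1)) (p.1, extChartAt (𝓡 m) p.2 p.2) w) =
      lam * ((φ (xi α p.1) ^ 2)⁻¹ * semiEuclidean ε v.1 w.1
        + f (xi α p.1) ^ 2 * gF.toFun p.2 v.2 w.2) := by
  obtain ⟨θ, -, hθ⟩ := hG.soliton
  refine ⟨θ, fun p v w => ?_⟩
  -- The chart on the `ℝⁿ` factor is the identity, so functions of `ξ` keep their form.
  have hchart : ∀ H : ℝ → ℝ, (fun p : EuclideanSpace ℝ (Fin n) × F => H (xi α p.1)) ∘
        (extChartAt ((𝓡 n).prod (𝓡 m)) p).symm = fun y => H (xiCLM α y.1) := fun H => by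
    funext y
    rw [xiCLM_apply, extChartAt_prod]
    rfl
  have hp : extChartAt ((𝓡 n).prod (𝓡 m)) p p = (p.1, extChartAt (𝓡 m) p.2 p.2) := by
    rw [extChartAt_prod]
    rfl
  have h1 := hθ p v w
  have hev := inChart_warpedProduct_eventuallyEq gF ε α φ f hφ hφ0 hf hf0 p
  have hdu := differential_eq _ p (hG.smooth_map.mdifferentiableAt (by simp))
  rw [hdu v, hdu w, ricci_eq _ p v w, hessian_eq _ _ p v w, hchart, hchart, coordRicci_congr hev, coordHessian_congr hev,
    hp] at h1
  exact h1.trans (congrArg (lam * ·) (warpedField_apply _ _ _ p v w))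

end SemiEuclidean

end SemiRiem

end

/-! ### Conclusion: steadiness and Ricci-flat fibre. -/

theorem mainTheorem5 {n m : ℕ} (hm : 0 < m)
    {F : Type*} [TopologicalSpace F] [ChartedSpace (EuclideanSpace ℝ (Fin m)) F]
    [IsManifold (𝓡 m) ∞ F] [Nonempty F]
    (gF : SemiRiemannianMetric (𝓡 m) F)
    (ε : Fin n → ℤˣ) (α : EuclideanSpace ℝ (Fin n)) (hα : α ≠ 0)
    (φ f h u : ℝ → ℝ)
    (hφ : ContDiff ℝ ∞ φ) (hφ0 : ∀ t, φ t ≠ 0)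
    (hf : ContDiff ℝ ∞ f) (hf0 : ∀ t, 0 < f t)
    (hu : ¬ ∃ c, ∀ t, u t = c)
    (lam : ℝ)
    (hG : (warpedProduct
        (conformalMetric ε (fun x => φ (xi α x)) (hφ.comp (contDiff_xi α)) (fun x => hφ0 (xi α x)))
        gF (fun x => f (xi α x)) (hf.comp (contDiff_xi α)).contMDiff
        (fun x => hf0 (xi α x))).IsGRHS
      (fun p => h (xi α p.1)) (fun p => u (xi α p.1)) lam)
    (hnull : ∑ i, ((ε i : ℤ) : ℝ) * α i ^ 2 = 0) :
    lam = 0 ∧ gF.IsRicciFlat ∧ ∀ μ : ℝ, gF.IsEinsteinWith μ → μ = 0 := by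
  obtain ⟨θ, hθ⟩ := soliton_warpedCoord gF ε α φ f h u hφ hφ0 hf hf0 lam hG
  have hψ : ContDiff ℝ ∞ fun t => (φ t ^ 2)⁻¹ :=
    (hφ.pow 2).inv fun t => pow_ne_zero 2 (hφ0 t)
  have hκ : ContDiff ℝ ∞ fun t => f t ^ 2 := hf.pow 2
  have hψ0 : ∀ t, (φ t ^ 2)⁻¹ ≠ 0 := fun t => inv_ne_zero (pow_ne_zero 2 (hφ0 t))
  have hκ0 : ∀ t, f t ^ 2 ≠ 0 := fun t => (pow_pos (hf0 t) 2).ne'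
  have hb := isInvertible_semiEuclidean ε
  have ha := semiEuclidean_xiGrad ε α
  have hl : xiCLM α (xiGrad ε α) = 0 := (xiCLM_xiGrad ε α).trans hnull
  have hlam : lam = 0 := by
    obtain ⟨q⟩ := ‹Nonempty F›
    -- The left side vanishes, while the metric pairing is `φ⁻² ξ(α) ≠ 0`; the base point `0` is
    -- arbitrary.
    have h1 := hθ (0, q) (xiGrad ε α, 0) (α, 0)
    have hγ := eventually_contDiffAt_inChart gF q
    rw [coordRicci_warpedCoord_null hψ hκ hψ0 hκ0 hb ha hl hγ,
      coordHessian_warpedCoord_null hψ hκ hψ0 hκ0 hb ha hl hγ.self_of_nhds.1 hγ.self_of_nhds.2,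
      fderiv_apply_eq_zero_of_invariant fun y s => by simp [hl], ha] at h1
    have h0 : gF.toFun q (0 : TangentSpace (𝓡 m) q) (0 : TangentSpace (𝓡 m) q) = 0 := map_zero _
    erw [h0] at h1
    simpa [hψ0, hφ0, xiCLM_self_ne_zero hα] using h1.symm
  have hric : ∀ (q : F) (w z : EuclideanSpace ℝ (Fin m)),
      coordRicci (inChart gF.toFun q) (extChartAt (𝓡 m) q q) w z = 0 := fun q w z => by
    have h1 := hθ (0, q) (0, w) (0, z)
    have hγ := eventually_contDiffAt_inChart gF q
    rw [coordRicci_warpedCoord_fiber hψ hκ hψ0 hκ0 hb (semiEuclidean_symm ε) ha hl hγ,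
      coordHessian_warpedCoord_fiber hψ hκ hψ0 hκ0 hb ha hl hγ.self_of_nhds.1 hγ.self_of_nhds.2,
      fderiv_apply_eq_zero_of_invariant fun y s => by simp, hlam] at h1
    simpa using h1
  have hflat : gF.IsRicciFlat := fun q w z => (ricci_eq gF q w z).trans (hric q w z)
  refine ⟨hlam, hflat, fun μ hμ => ?_⟩
  obtain ⟨q⟩ := ‹Nonempty F›
  -- If `μ ≠ 0`, then `μ g_F = 0` and nondegeneracy force the tangent space at `q` to be zero,
  -- contradicting `m > 0`.
  by_contra hμ0
  have h0 : ∀ v : TangentSpace (𝓡 m) q, v = 0 := fun v => gF.nondegenerate q v fun w =>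
    (mul_eq_zero.1 ((hμ q v w).symm.trans (hflat q v w))).resolve_left hμ0
  have h1 : (EuclideanSpace.single (⟨0, hm⟩ : Fin m) (1 : ℝ)) = 0 := h0 _
  simp at h1
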